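/- Let $d\ge 1$, let $K\subset\mathbb C^d$ be compact, and let $w:K\to[0,\infty)$ be an admissible weight, i.e. $w$ is upper semicontinuous and $\{z\in K: w(z)>0\}$ is not pluripolar. For $n\ge 1$ let $\mathcal P_n$ be the space of holomorphic polynomials on $\mathbb C^d$ of degree at most $n$, let $N=\binom{d+n}{n}=\dim\mathcal P_n$, let $p_1,\dots,p_N$ be the monomials of degree at most $n$, and let $m_n=dnN/(d+1)$ be the sum of their degrees. For a probability measure $\mu$ on $K$ put $$\langle f,g\rangle_{\mu,w}=\int_K f\,\overline g\,w^{2n}\,d\mu,\qquad G_n^{\mu,w}=[\langle p_i,p_j\rangle_{\mu,w}]_{i,j=1}^N .$$ Call $\mu$ an optimal measure of degree $n$ for $K$ and $w$ if it has either of the following two (equivalent) properties: (a) $\det G_n^{\mu',w}\le\det G_n^{\mu,w}$ for all probability measures $\mu'$ on $K$; (b) $\mathcal P_n$ has an orthonormal basis $q_1,\dots,q_N$ with respect to $\langle\cdot,\cdot\rangle_{\mu,w}$, and $\max_{z\in K}\sum_{j=1}^N|q_j(z)|^2w(z)^{2n}=N$. Let $$\delta_n^w(K)=\Bigl(\max_{z_1,\dots,z_N\in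 K}\bigl|\det[p_i(z_j)]_{i,j=1}^N\bigr|\,w(z_1)^n\cdots w(z_N)^n\Bigr)^{1/m_n}.$$ Suppose that for every $n\ge 1$ the measure $\mu_n$ is an optimal measure of degree $n$ for $K$ and $w$. Then the limit $\delta^w(K)=\lim_{n\to\infty}\delta_n^w(K)$ (the weighted transfinite diameter of $K$) exists, and $$\lim_{n\to\infty}\det\bigl(G_n^{\mu_n,w}\bigr)^{1/(2m_n)}=\delta^w(K).$$ -/

import Mathlib

open Filter Topology MeasureTheory

namespace WeightedOptimal

/-! ### Plurisubharmonic functions and pluripolar sets -/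

/-- The mean of `v` over the circle of centre `a` and radius `r`, as the difference of the Lebesgue
integrals of the positive and the negative part. For an upper semicontinuous `v` with values in
`[-∞, ∞)` the first integral is finite, so that this is the usual mean, with values in `[-∞, ∞)`. -/
noncomputable def circleMean (v : ℂ → EReal) (a : ℂ) (r : ℝ) : EReal :=
  (((2 * Real.pi)⁻¹ : ℝ) : EReal) *
    (((∫⁻ θ in Set.Ioc 0 (2 * Real.pi), (v (circleMap a r θ)).toENNReal : ENNReal) : EReal) -
      ((∫⁻ θ in Set.Ioc 0 (2 * Real.pi), (-v (circleMap a r θ)).toENNReal : ENNReal) : EReal))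

/-- Subharmonic functions on `ℂ` (the function identically `-∞` is not counted as one). -/
structure IsSubharmonic (v : ℂ → EReal) : Prop where
  lt_top : ∀ z, v z < ⊤
  usc : UpperSemicontinuous v
  submean : ∀ (a : ℂ) (r : ℝ), 0 < r → v a ≤ circleMean v a r
  ne_bot : ∃ z, v z ≠ ⊥

/-- Plurisubharmonic functions `u : ℂ^d → [-∞, ∞)`: upper semicontinuous and, on every complex
line, either subharmonic or identically `-∞`. -/
structure IsPlurisubharmonic {d : ℕ} (u : (Fin d → ℂ) → EReal) : Prop where
  lt_top : ∀ z, u z < ⊤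
  usc : UpperSemicontinuous u
  line : ∀ a b : Fin d → ℂ, b ≠ 0 →
    IsSubharmonic (fun t : ℂ => u (a + t • b)) ∨ ∀ t : ℂ, u (a + t • b) = ⊥

/-- `E` is contained in the `-∞` set of a plurisubharmonic function that is not identically `-∞`. -/
def IsPluripolar {d : ℕ} (E : Set (Fin d → ℂ)) : Prop :=
  ∃ u : (Fin d → ℂ) → EReal, IsPlurisubharmonic u ∧ (∃ z, u z ≠ ⊥) ∧ E ⊆ {z | u z = ⊥}

/-- Admissible weight functions `w : K → ℝ`. -/
structure IsAdmissible {d : ℕ} (K : Set (Fin d → ℂ)) (w : K → ℝ) : Prop where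
  nonneg : ∀ z, 0 ≤ w z
  usc : UpperSemicontinuous w
  not_pluripolar : ¬ IsPluripolar ((fun z : K => (z : Fin d → ℂ)) '' {z : K | 0 < w z})

/-! ### Monomials of degree at most `n` -/

/-- The exponents of the monomials in `d` variables of degree at most `n`. -/
abbrev Exponent (d n : ℕ) : Type := {α : Fin d → ℕ // ∑ i, α i ≤ n}

theorem Exponent.le {d n : ℕ} (α : Exponent d n) (i : Fin d) : α.1 i ≤ n :=
  (Finset.single_le_sum (f := α.1) (fun _ _ => Nat.zero_le _) (Finset.mem_univ i)).trans α.2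

noncomputable instance instFintypeExponent (d n : ℕ) : Fintype (Exponent d n) :=
  Fintype.ofInjective
    (fun (α : Exponent d n) (i : Fin d) => (⟨α.1 i, Nat.lt_succ_of_le (α.le i)⟩ : Fin (n + 1)))
    (fun α β h => Subtype.ext (funext fun i => congrArg Fin.val (congrFun h i)))

/-- The monomial `z ↦ z ^ α`. -/
def monomialFun {d n : ℕ} (α : Exponent d n) (z : Fin d → ℂ) : ℂ := ∏ i, z i ^ α.1 i

/-- `N`, the dimension of the space of polynomials of degree at most `n` in `d` variables. -/
def polyDim (d n : ℕ) : ℕ := (d + n).choose n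

/-- `m_n = d n N / (d + 1)`, the sum of the degrees of the monomials of degree at most `n`. -/
noncomputable def degreeSum (d n : ℕ) : ℝ := (d * n * polyDim d n : ℝ) / (d + 1)

/-! ### The weighted inner product, Gram matrices and optimal measures -/

section Gram

variable {d : ℕ} {K : Set (Fin d → ℂ)}

/-- `⟨f, g⟩ = ∫_K f(z) conj(g(z)) w(z)^(2n) dμ(z)`. -/
noncomputable def weightedInner (n : ℕ) (w : K → ℝ) (μ : ProbabilityMeasure K)
    (f g : (Fin d → ℂ) → ℂ) : ℂ :=
  ∫ z : K, f z * (starRingEnd ℂ) (g z) * ((w z ^ (2 * n) : ℝ) : ℂ) ∂(μ : Measure K)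

/-- The Gram matrix of the monomial basis. -/
noncomputable def gramMatrix (n : ℕ) (w : K → ℝ) (μ : ProbabilityMeasure K) :
    Matrix (Exponent d n) (Exponent d n) ℂ :=
  Matrix.of fun α β => weightedInner n w μ (monomialFun α) (monomialFun β)

/-- The determinant of the Gram matrix as a real number; see `ofReal_gramDet`. -/
noncomputable def gramDet (n : ℕ) (w : K → ℝ) (μ : ProbabilityMeasure K) : ℝ :=
  (gramMatrix n w μ).det.re

theorem gramMatrix_isHermitian (n : ℕ) (w : K → ℝ) (μ : ProbabilityMeasure K) :
    (gramMatrix n w μ).IsHermitian := by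
  ext α β
  simp only [Matrix.conjTranspose_apply, gramMatrix, Matrix.of_apply, weightedInner,
    RCLike.star_def]
  rw [← integral_conj]
  congr 1
  ext z
  simp only [map_mul, Complex.conj_conj, Complex.conj_ofReal]
  ring

theorem ofReal_gramDet (n : ℕ) (w : K → ℝ) (μ : ProbabilityMeasure K) :
    ((gramDet n w μ : ℝ) : ℂ) = (gramMatrix n w μ).det := by
  have h := Matrix.det_conjTranspose (gramMatrix n w μ)
  rw [(gramMatrix_isHermitian n w μ).eq] at h
  exact Complex.conj_eq_iff_re.1 h.symm

/-- `q` is an orthonormal basis, for the weighted inner product, of the space of polynomials of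
degree at most `n` (its `N` members are linearly independent by orthonormality). -/
def IsOrthonormalBasis (n : ℕ) (w : K → ℝ) (μ : ProbabilityMeasure K)
    (q : Exponent d n → MvPolynomial (Fin d) ℂ) : Prop :=
  (∀ α, (q α).totalDegree ≤ n) ∧
    ∀ α β, weightedInner n w μ (fun z => MvPolynomial.eval z (q α))
      (fun z => MvPolynomial.eval z (q β)) = if α = β then 1 else 0

/-- The weighted Christoffel function of an orthonormal basis `q`. -/
noncomputable def christoffel (n : ℕ) (w : K → ℝ) (q : Exponent d n → MvPolynomial (Fin d) ℂ)
    (z : K) : ℝ :=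
  ∑ α, ‖MvPolynomial.eval (z : Fin d → ℂ) (q α)‖ ^ 2 * w z ^ (2 * n)

/-- Property (a): `μ` maximizes the Gram determinant among the probability measures on `K`. -/
def MaximizesGramDet (n : ℕ) (w : K → ℝ) (μ : ProbabilityMeasure K) : Prop :=
  ∀ μ' : ProbabilityMeasure K, gramDet n w μ' ≤ gramDet n w μ

/-- Property (b): the maximum over `K` of the weighted Christoffel function of `μ` is `N`. The
Christoffel function does not depend on the choice of the orthonormal basis. -/
def ChristoffelMaxEqDim (n : ℕ) (w : K → ℝ) (μ : ProbabilityMeasure K) : Prop :=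
  ∃ q : Exponent d n → MvPolynomial (Fin d) ℂ, IsOrthonormalBasis n w μ q ∧
    IsGreatest (Set.range (christoffel n w q)) (polyDim d n : ℝ)

/-- Optimal measures of degree `n` for `K` and `w`: one of the two (equivalent) properties holds. -/
def IsOptimalMeasure (n : ℕ) (w : K → ℝ) (μ : ProbabilityMeasure K) : Prop :=
  MaximizesGramDet n w μ ∨ ChristoffelMaxEqDim n w μ

/-! ### The weighted transfinite diameter -/

/-- The Vandermonde determinant of `N` points for the monomial basis; points are indexed by the
exponents, which only affects its sign. -/
noncomputable def vandermondeDet (n : ℕ) (z : Exponent d n → Fin d → ℂ) : ℂ :=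
  (Matrix.of fun α β => monomialFun α (z β) : Matrix (Exponent d n) (Exponent d n) ℂ).det

/-- The `n`th order weighted transfinite diameter. -/
noncomputable def transfiniteDiameterOfOrder (w : K → ℝ) (n : ℕ) : ℝ :=
  (⨆ z : Exponent d n → K, ‖vandermondeDet n (fun α => (z α : Fin d → ℂ))‖ * ∏ α, w (z α) ^ n) ^
    (1 / degreeSum d n)

/-- The weighted transfinite diameter `δ^w(K)`, the limit of those of order `n`. -/
noncomputable def transfiniteDiameter (w : K → ℝ) : ℝ :=
  limUnder atTop (transfiniteDiameterOfOrder w)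

end Gram

end WeightedOptimal

namespace WeightedOptimal

/-! ### Averages of subadditive functions over the lattice points of a simplex -/

section Simplex

open Finset

variable {ι : Type*} [Fintype ι] [DecidableEq ι]

/-! Write `V_n` for the maximal weighted Vandermonde determinant, so that `δ_n = V_n ^ (1 / m_n)`.

Gram side: by Andréief's identity `N! det G` is the integral of the squared weighted Vandermonde
over `K^N`, so `det G ≤ V_n²`. For an optimal measure `V_n² ≤ N^N det G`: under (a) compare with the
uniform measure on `N` points, under (b) apply Hadamard's inequality to the orthonormal basis
(`maxVandermonde_sq_le`). As `(N^N)^(1 / m_n) → 1`, the two sequences have the same limit once one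
exists.

Existence of the limit: up to a factor between `1` and `N!`, `V_n` is the product over `|α| ≤ n` of
the weighted Chebyshev constants `T_n(α)` (`prod_chebyshevConstant_le`, `maxVandermonde_le`).
Multiplying polynomials gives `T_{n+m}(α+β) ≤ T_n(α) T_m(β)`. With a slack coordinate the pairs `(n,
α)` become lattice points of dilated simplices in `d + 1` coordinates. The mean of `log T` over the
simplex of size `n` is subadditive in `n` (`subadditive_simplexMean`), and Fekete's lemma applies.
The case where some `T` vanishes is separate, with limit `0`. -/

theorem sum_prod_choose_eq_choose (a : ι →₀ ℕ) (n : ℕ) :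
    ∑ b ∈ finsuppAntidiag univ n, ∏ i, (a i).choose (b i) = (∑ i, a i).choose n := by
  -- Multivariate Vandermonde convolution: compare coefficients of `X ^ n`.
  have h : ∏ i, ((1 + PowerSeries.X : PowerSeries ℕ) ^ a i) = (1 + PowerSeries.X) ^ ∑ i, a i :=
    Finset.prod_pow_eq_pow_sum _ _ _
  have hc : ∀ k j : ℕ, PowerSeries.coeff j ((1 + PowerSeries.X : PowerSeries ℕ) ^ k) = k.choose j := by
    intro k j
    have := Polynomial.coeff_one_add_X_pow ℕ k j
    rw [← Polynomial.coeff_coe] at this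
    simpa using this
  have := congrArg (PowerSeries.coeff n) h
  rw [PowerSeries.coeff_prod, hc] at this
  simpa only [hc] using this

/-- Compare coefficients of `X ^ m` in the product of the series `(1 - X)^-(b i + 1)`; the `d + 1`
extra ones in the exponents produce the shift by `d`. -/
theorem sum_prod_add_choose_eq_choose {d : ℕ} (hd : Fintype.card ι = d + 1) (b : ι →₀ ℕ) (m : ℕ) :
    ∑ c ∈ finsuppAntidiag univ m, ∏ i, (b i + c i).choose (b i) =
      (∑ i, b i + d + m).choose (∑ i, b i + d) := by
  have h : ∏ i, PowerSeries.invOneSubPow ℤ (b i + 1) =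
      PowerSeries.invOneSubPow ℤ (∑ i, b i + d + 1) := by
    simp only [PowerSeries.invOneSubPow_eq_inv_one_sub_pow]
    rw [Finset.prod_pow_eq_pow_sum, Finset.sum_add_distrib]
    simp [hd, add_assoc]
  have := congrArg (fun u : (PowerSeries ℤ)ˣ => PowerSeries.coeff m u.val) h
  simp only [Units.coe_prod, PowerSeries.invOneSubPow_val_succ_eq_mk_add_choose,
    PowerSeries.coeff_prod, PowerSeries.coeff_mk] at this
  exact_mod_cast this

theorem card_finsuppAntidiag_univ {d : ℕ} (hd : Fintype.card ι = d + 1) (m : ℕ) :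
    #(finsuppAntidiag (univ : Finset ι) m) = polyDim d m := by
  have := sum_prod_add_choose_eq_choose hd 0 m
  simp only [Finsupp.coe_zero, Pi.zero_apply, Nat.choose_zero_right, Finset.prod_const_one,
    Finset.sum_const, smul_eq_mul, mul_one, zero_add, mul_zero] at this
  rw [this, polyDim, Nat.choose_symm_add]

theorem sum_prod_choose_mul_add (f : (ι →₀ ℕ) → ℝ) (b : ι →₀ ℕ) (m : ℕ) :
    ∑ c ∈ finsuppAntidiag univ m, ((∏ i, (b i + c i).choose (b i) : ℕ) : ℝ) * f (b + c) =
      ∑ a ∈ finsuppAntidiag univ (∑ i, b i + m), ((∏ i, (a i).choose (b i) : ℕ) : ℝ) * f a := by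
  refine (Finset.sum_map (finsuppAntidiag univ m) (addLeftEmbedding b)
    (fun a => ((∏ i, (a i).choose (b i) : ℕ) : ℝ) * f a)).symm.trans ?_
  refine Finset.sum_subset ?_ ?_
  · intro a ha
    obtain ⟨c, hc, rfl⟩ := Finset.mem_map.1 ha
    rw [mem_finsuppAntidiag] at hc ⊢
    simp [← hc.1, Finset.sum_add_distrib]
  · intro a ha hna
    -- Points `a` not of the form `b + c` contribute nothing: some binomial coefficient vanishes.
    have : ¬ b ≤ a := by
      intro hle
      refine hna (Finset.mem_map.2 ⟨a - b, ?_, by simp [hle]⟩)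
      rw [mem_finsuppAntidiag] at ha ⊢
      refine ⟨?_, by simp⟩
      have h2 : ∑ i, (a - b) i + ∑ i, b i = ∑ i, a i := by
        rw [← Finset.sum_add_distrib]
        exact Finset.sum_congr rfl fun i _ => by simp [hle i]
      have := ha.1
      change ∑ i, (a - b) i = m
      change ∑ i, a i = _ at this
      omega
    obtain ⟨i, hi⟩ := not_forall.1 (fun h => this (Finsupp.le_def.2 h))
    rw [Finset.prod_eq_zero (Finset.mem_univ i) (Nat.choose_eq_zero_of_lt (not_le.1 hi))]
    simp

/-- The mean of `f` over the lattice points of the simplex of size `n`. -/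
noncomputable def simplexMean (f : (ι →₀ ℕ) → ℝ) (n : ℕ) : ℝ :=
  (∑ a ∈ finsuppAntidiag univ n, f a) / #(finsuppAntidiag (univ : Finset ι) n)

/-- The Bose-Einstein distribution is stable under sampling, so that the means of a subadditive
function over the lattice points of dilated simplices are subadditive. -/
theorem subadditive_simplexMean [Nonempty ι] (f : (ι →₀ ℕ) → ℝ)
    (hf : ∀ a b, f (a + b) ≤ f a + f b) : Subadditive (simplexMean f) := by
  intro n m
  obtain ⟨d, hd⟩ : ∃ d, Fintype.card ι = d + 1 :=
    ⟨Fintype.card ι - 1, by have := Fintype.card_pos (α := ι); omega⟩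
  have hsum : ∀ {k : ℕ} {a : ι →₀ ℕ}, a ∈ finsuppAntidiag (univ : Finset ι) k → ∑ i, a i = k :=
    fun h => (mem_finsuppAntidiag.1 h).1
  -- Once normalized, `W` couples the uniform distributions on the simplices of sizes `n` and `m` so
  -- that `b + c` is uniform on the simplex of size `n + m`. `h1`, `h2` and `h3` compute the three
  -- marginals, and `hid` shows that their normalizations agree.
  set W : (ι →₀ ℕ) → (ι →₀ ℕ) → ℝ := fun b c => ((∏ i, (b i + c i).choose (b i) : ℕ) : ℝ) with hW
  have h1 : ∑ b ∈ finsuppAntidiag univ n, ∑ c ∈ finsuppAntidiag univ m, W b c * f (b + c) =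
      (n + m).choose n * ∑ a ∈ finsuppAntidiag univ (n + m), f a := by
    rw [Finset.sum_congr rfl fun b hb => by
      rw [hW, sum_prod_choose_mul_add f b m, hsum hb], Finset.sum_comm, Finset.mul_sum]
    refine Finset.sum_congr rfl fun a ha => ?_
    rw [← Finset.sum_mul, ← Nat.cast_sum, sum_prod_choose_eq_choose, hsum ha]
  have h2 : ∑ b ∈ finsuppAntidiag univ n, ∑ c ∈ finsuppAntidiag univ m, W b c * f b =
      (n + d + m).choose (n + d) * ∑ a ∈ finsuppAntidiag univ n, f a := by
    rw [Finset.mul_sum]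
    refine Finset.sum_congr rfl fun b hb => ?_
    rw [← Finset.sum_mul, ← Nat.cast_sum, sum_prod_add_choose_eq_choose hd, hsum hb]
  have h3 : ∑ b ∈ finsuppAntidiag univ n, ∑ c ∈ finsuppAntidiag univ m, W b c * f c =
      (m + d + n).choose (m + d) * ∑ a ∈ finsuppAntidiag univ m, f a := by
    rw [Finset.sum_comm, Finset.mul_sum]
    refine Finset.sum_congr rfl fun c hc => ?_
    have : ∀ b : ι →₀ ℕ, W b c = ((∏ i, (c i + b i).choose (c i) : ℕ) : ℝ) := fun b => by
      simp only [hW]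
      congr 1
      exact Finset.prod_congr rfl fun i _ => by rw [add_comm, Nat.choose_symm_add]
    rw [← Finset.sum_mul, Finset.sum_congr rfl fun b _ => this b, ← Nat.cast_sum,
      sum_prod_add_choose_eq_choose hd, hsum hc]
  have h4 : ((n + m).choose n : ℝ) * ∑ a ∈ finsuppAntidiag univ (n + m), f a ≤
      (n + d + m).choose (n + d) * ∑ a ∈ finsuppAntidiag univ n, f a +
      (m + d + n).choose (m + d) * ∑ a ∈ finsuppAntidiag univ m, f a := by
    rw [← h1, ← h2, ← h3, ← Finset.sum_add_distrib]
    refine Finset.sum_le_sum fun b _ => ?_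
    rw [← Finset.sum_add_distrib]
    refine Finset.sum_le_sum fun c _ => ?_
    rw [← mul_add]
    exact mul_le_mul_of_nonneg_left (hf b c) (Nat.cast_nonneg _)
  have hid : ∀ n m : ℕ, (n + d + m).choose (n + d) * polyDim d n =
      (n + m).choose n * polyDim d (n + m) := fun n m => by
    rw [polyDim, polyDim]
    have e1 := Nat.add_choose_mul_factorial_mul_factorial (n + d) m
    have e2 := Nat.add_choose_mul_factorial_mul_factorial d n
    have e3 := Nat.add_choose_mul_factorial_mul_factorial n m
    have e4 := Nat.add_choose_mul_factorial_mul_factorial d (n + m)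
    rw [← Nat.choose_symm_add] at e1 e3
    have hp : 0 < d.factorial * n.factorial * m.factorial := by positivity
    refine Nat.eq_of_mul_eq_mul_right hp ?_
    calc _ = (n + d + m).choose (n + d) * ((d + n).choose n * d.factorial * n.factorial) *
          m.factorial := by ring
      _ = (n + d + m).factorial := by rw [e2, add_comm d n, e1]
      _ = (d + (n + m)).choose (n + m) * d.factorial * ((n + m).choose n * n.factorial *
          m.factorial) := by rw [e3, e4]; congr 1; ring
      _ = _ := by ring
  have hpos : ∀ k, (0 : ℝ) < polyDim d k := fun k =>
    Nat.cast_pos.2 (Nat.choose_pos (Nat.le_add_left _ _))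
  have i1 : ((n + d + m).choose (n + d) : ℝ) = (n + m).choose n * polyDim d (n + m) / polyDim d n := by
    rw [eq_div_iff (hpos n).ne']; exact_mod_cast hid n m
  have i2 : ((m + d + n).choose (m + d) : ℝ) = (n + m).choose n * polyDim d (n + m) / polyDim d m := by
    rw [eq_div_iff (hpos m).ne']
    have := hid m n
    rw [add_comm m n, Nat.choose_symm_add (a := n) (b := m) |>.symm] at this
    exact_mod_cast this
  have hc : (0 : ℝ) < (n + m).choose n := Nat.cast_pos.2 (Nat.choose_pos (Nat.le_add_right _ _))
  simp only [simplexMean, card_finsuppAntidiag_univ hd]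
  rw [i1, i2] at h4
  rw [div_le_iff₀ (hpos _)]
  refine le_of_mul_le_mul_left (h4.trans_eq ?_) hc
  have := (hpos n).ne'; have := (hpos m).ne'
  field_simp

theorem _root_.Subadditive.tendsto_div_or_atBot {u : ℕ → ℝ} (hu : Subadditive u) :
    (∃ L, Tendsto (fun n => u n / n) atTop (𝓝 L)) ∨ Tendsto (fun n => u n / n) atTop atBot := by
  by_cases h : BddBelow (Set.range fun n => u n / n)
  · exact Or.inl ⟨_, hu.tendsto_lim h⟩
  · refine Or.inr (tendsto_atBot.2 fun b => ?_)
    -- The minimum with `0` excludes `n = 0`, where the quotient is `0` by convention.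
    obtain ⟨_, ⟨n, rfl⟩, hn⟩ := not_bddBelow_iff.1 h (min b 0)
    have hn0 : n ≠ 0 := by
      rintro rfl
      simp at hn
    filter_upwards [hu.eventually_div_lt_of_div_lt hn0 (hn.trans_le (min_le_left _ _))] with m hm
    exact hm.le

/-- For a submultiplicative function `T` the means of `log T` over the dilated simplices converge
exponentially. -/
theorem exists_tendsto_prod_rpow [Nonempty ι] {d : ℕ} (hd : Fintype.card ι = d + 1)
    (T : (ι →₀ ℕ) → ℝ) (h0 : ∀ a, 0 ≤ T a)
    (hT : ∀ a b, T (a + b) ≤ T a * T b) (s : ℝ) (hs : 0 < s) :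
    ∃ L, Tendsto (fun n : ℕ => (∏ a ∈ finsuppAntidiag univ n, T a) ^ (1 / (s * (n * polyDim d n))))
      atTop (𝓝 L) := by
  have hpos : ∀ k, (0 : ℝ) < polyDim d k := fun k =>
    Nat.cast_pos.2 (Nat.choose_pos (Nat.le_add_left _ _))
  by_cases hz : ∃ a, T a = 0
  · obtain ⟨a, ha⟩ := hz
    refine ⟨0, tendsto_const_nhds.congr' ?_⟩
    -- A zero at `a` propagates to some point of every larger simplex; the strict inequality also
    -- keeps the exponent nonzero, so that the power of `0` is `0`.
    filter_upwards [eventually_gt_atTop (∑ i, a i)] with n hn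
    obtain ⟨i⟩ := ‹Nonempty ι›
    rw [Finset.prod_eq_zero (i := a + Finsupp.single i (n - ∑ i, a i)), Real.zero_rpow]
    · have : (0 : ℝ) < n := by exact_mod_cast (Nat.zero_le _).trans_lt hn
      have := hpos n
      positivity
    · rw [mem_finsuppAntidiag]
      refine ⟨?_, by simp⟩
      change ∑ j, (a + Finsupp.single i (n - ∑ i, a i)) j = n
      simp only [Finsupp.add_apply, Finset.sum_add_distrib]
      rw [Finsupp.univ_sum_single_apply]
      omega
    · refine le_antisymm ((hT _ _).trans ?_) (h0 _)
      rw [ha, zero_mul]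
  · have hTpos : ∀ a, 0 < T a := fun a => (h0 a).lt_of_ne' fun h => hz ⟨a, h⟩
    have hsub := subadditive_simplexMean (fun a => Real.log (T a)) fun a b => by
      rw [← Real.log_mul (hTpos a).ne' (hTpos b).ne']
      exact Real.log_le_log (hTpos _) (hT a b)
    have heq : ∀ n : ℕ, (∏ a ∈ finsuppAntidiag univ n, T a) ^ (1 / (s * (n * polyDim d n))) =
        Real.exp (simplexMean (fun a => Real.log (T a)) n / n * s⁻¹) := fun n => by
      rw [Real.rpow_def_of_pos (Finset.prod_pos fun a _ => hTpos a),
        Real.log_prod fun a _ => (hTpos a).ne', simplexMean, card_finsuppAntidiag_univ hd]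
      congr 1
      simp only [div_eq_mul_inv, mul_inv, one_mul]
      ring
    simp only [heq]
    rcases hsub.tendsto_div_or_atBot with ⟨L, hL⟩ | hL
    · exact ⟨_, (Real.continuous_exp.tendsto _).comp (hL.mul_const _)⟩
    · exact ⟨0, Real.tendsto_exp_atBot.comp (hL.atBot_mul_const (inv_pos.2 hs))⟩

end Simplex

/-! ### Determinants of values of functions -/

section Determinants

open Finset

variable {ι X : Type*} [Fintype ι]

/-- Passing from `φ` to `ψ` multiplies the matrix by a unipotent triangular one, which preserves the
determinant; the Leibniz formula then has `N!` terms, each at most `∏ C i`. -/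
theorem norm_det_le_of_triangular [LinearOrder ι] (φ ψ : ι → X → ℂ) (c : ι → ι → ℂ)
    (hψ : ∀ i x, ψ i x = φ i x + ∑ j, if j < i then c i j * φ j x else 0)
    (C : ι → ℝ) (hC : ∀ i x, ‖ψ i x‖ ≤ C i) (x : ι → X) :
    ‖(Matrix.of fun i j => φ i (x j) : Matrix ι ι ℂ).det‖ ≤
      (Fintype.card ι).factorial * ∏ i, C i := by
  set A : Matrix ι ι ℂ := Matrix.of fun i j => φ i (x j)
  set U : Matrix ι ι ℂ := Matrix.of fun i j => if j < i then c i j else if j = i then 1 else 0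
  have hU : U.det = 1 := by
    rw [Matrix.det_of_isLowerTriangular U fun i j hij => ?_]
    · simp [U]
    · have hij : i < j := hij
      simp [U, hij.not_gt, hij.ne']
  have hUA : U * A = Matrix.of fun i j => ψ i (x j) := by
    ext i j
    simp only [Matrix.mul_apply, U, A, Matrix.of_apply, hψ]
    have : ∀ k, (if k < i then c i k else if k = i then 1 else 0) * φ k (x j) =
        (if k = i then φ k (x j) else 0) + if k < i then c i k * φ k (x j) else 0 := fun k => by
      by_cases h : k < i
      · simp [h, h.ne]
      · simp [h]
    simp [this, Finset.sum_add_distrib]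
  have hA : A.det = (Matrix.of fun i j => ψ i (x j) : Matrix ι ι ℂ).det := by
    rw [← hUA, Matrix.det_mul, hU, one_mul]
  rw [hA, Matrix.det_apply]
  refine (norm_sum_le _ _).trans ?_
  refine (Finset.sum_le_card_nsmul _ _ (∏ i, C i) fun σ _ => ?_).trans_eq ?_
  · have : ‖(Equiv.Perm.sign σ : ℤˣ) • ∏ i, (Matrix.of fun i j => ψ i (x j) : Matrix ι ι ℂ) (σ i) i‖
        = ∏ i, ‖ψ (σ i) (x i)‖ := by
      rw [← norm_prod]
      rcases Int.units_eq_one_or (Equiv.Perm.sign σ) with h | h <;> simp [h]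
    rw [this, ← Equiv.prod_comp σ C]
    exact Finset.prod_le_prod (fun _ _ => norm_nonneg _) fun i _ => hC _ _
  · simp [Fintype.card_perm]

/-- Induction on the number of points. With all points but the last fixed, the determinant is the
smaller determinant `D` times a monic combination in the last point, whose supremum is at least the
last `T`. Hence `‖D‖ * T ≤ B`, and the induction hypothesis applies with `B / T`. -/
theorem prod_le_of_norm_det_le_fin [Nonempty X] : ∀ (N : ℕ) (φ : Fin N → X → ℂ) (T : Fin N → ℝ)
    (_ : ∀ i, 0 ≤ T i)
    (_ : ∀ i (c : Fin N → ℂ) C,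
      (∀ x, ‖φ i x + ∑ j, if j < i then c j * φ j x else 0‖ ≤ C) → T i ≤ C)
    (B : ℝ) (_ : ∀ x : Fin N → X,
      ‖(Matrix.of fun i j => φ i (x j) : Matrix (Fin N) (Fin N) ℂ).det‖ ≤ B), ∏ i, T i ≤ B := by
  intro N
  induction N with
  | zero =>
    intro φ T _ _ B hB
    simpa using hB Fin.elim0
  | succ N ih =>
    intro φ T h0 hT B hB
    obtain ⟨x₀⟩ := ‹Nonempty X›
    have hB0 : 0 ≤ B := (norm_nonneg _).trans (hB fun _ => x₀)
    rw [Fin.prod_univ_castSucc]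
    rcases (h0 (Fin.last N)).eq_or_lt with hz | hpos
    · rw [← hz, mul_zero]
      exact hB0
    rw [← le_div_iff₀ hpos]
    refine ih (fun i => φ i.castSucc) _ (fun i => h0 _) (fun i c C hC => ?_) _ fun y => ?_
    -- The padded coefficient is irrelevant, since the last index is below no other.
    · refine hT i.castSucc (Fin.snoc c 0) C fun x => ?_
      rw [Fin.sum_univ_castSucc]
      simpa only [Fin.snoc_castSucc, Fin.snoc_last, Fin.castSucc_lt_castSucc_iff, zero_mul, ite_self,
        add_zero] using hC x
    · set D := (Matrix.of fun i j => φ (Fin.castSucc i) (y j) : Matrix (Fin N) (Fin N) ℂ).det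
        with hD
      rw [le_div_iff₀ hpos]
      rcases eq_or_ne D 0 with hD0 | hD0
      · simp [hD0, hB0]
      have hDp : 0 < ‖D‖ := norm_pos_iff.2 hD0
      rw [mul_comm, ← le_div_iff₀ hDp]
      set m : Fin (N + 1) → ℂ := fun i => (-1) ^ (i + N : ℕ) *
        (Matrix.of fun (k : Fin N) (j : Fin N) => φ (i.succAbove k) (y j)).det
      have hm : m (Fin.last N) = D := by
        have : (-1 : ℂ) ^ (N + N) = 1 := (Even.add_self N).neg_one_pow
        simp only [m, hD, Fin.val_last, Fin.succAbove_last, this, one_mul]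
      -- The coefficients are the cofactors of the last column, made monic by dividing by `D`.
      refine hT (Fin.last N) (fun i => m i / D) _ fun x => ?_
      have hdet := hB (Fin.snoc y x)
      rw [Matrix.det_succ_column _ (Fin.last N)] at hdet
      rw [le_div_iff₀ hDp, ← norm_mul]
      refine le_of_eq_of_le (congrArg _ ?_) hdet
      have hterm : ∀ i : Fin (N + 1), (-1 : ℂ) ^ ((i : ℕ) + (Fin.last N : Fin (N + 1)) : ℕ) *
          (Matrix.of fun i j => φ i ((Fin.snoc y x : Fin (N + 1) → X) j)) i (Fin.last N) *
          ((Matrix.of fun i j => φ i ((Fin.snoc y x : Fin (N + 1) → X) j)).submatrix i.succAbove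
            (Fin.last N).succAbove).det = m i * φ i x := by
        intro i
        have : (Matrix.of fun i j => φ i ((Fin.snoc y x : Fin (N + 1) → X) j)).submatrix
            i.succAbove (Fin.last N).succAbove =
            Matrix.of fun (k : Fin N) (j : Fin N) => φ (i.succAbove k) (y j) := by
          ext k j
          simp
        rw [this]
        simp only [m, Matrix.of_apply, Fin.snoc_last, Fin.val_last]
        ring
      rw [Finset.sum_congr rfl fun i _ => hterm i, Fin.sum_univ_castSucc, Fin.sum_univ_castSucc, hm]
      simp only [Fin.castSucc_lt_last, if_true, lt_irrefl, if_false, add_zero, add_mul,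
        Finset.sum_mul]
      rw [add_comm, mul_comm D]
      congr 1
      refine Finset.sum_congr rfl fun i _ => ?_
      field_simp

theorem prod_le_of_norm_det_le [Nonempty X] [LinearOrder ι] (φ : ι → X → ℂ) (T : ι → ℝ)
    (h0 : ∀ i, 0 ≤ T i)
    (hT : ∀ i (c : ι → ℂ) C,
      (∀ x, ‖φ i x + ∑ j, if j < i then c j * φ j x else 0‖ ≤ C) → T i ≤ C)
    (B : ℝ) (hB : ∀ x : ι → X, ‖(Matrix.of fun i j => φ i (x j) : Matrix ι ι ℂ).det‖ ≤ B) :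
    ∏ i, T i ≤ B := by
  let e := monoEquivOfFin ι rfl
  rw [← Equiv.prod_comp e.toEquiv]
  refine prod_le_of_norm_det_le_fin _ (fun i => φ (e i)) _ (fun i => h0 _) (fun i c C hC => ?_) B
    fun x => ?_
  · refine hT _ (fun j => c (e.symm j)) C fun x => ?_
    rw [← Equiv.sum_comp e.toEquiv]
    simpa using hC x
  · have := hB (fun i => x (e.symm i))
    rw [← Matrix.det_submatrix_equiv_self e.toEquiv] at this
    convert this using 3
    ext i j
    simp

variable [DecidableEq ι]

/-- Triangular changes of functions, for the order of the index set given by `r`. -/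
theorem norm_det_le_of_triangular_lift {S : Type*} [LinearOrder S] {r : ι → S}
    (hr : Function.Injective r) (φ ψ : ι → X → ℂ) (c : ι → ι → ℂ)
    (hψ : ∀ i x, ψ i x = φ i x + ∑ j, if r j < r i then c i j * φ j x else 0)
    (C : ι → ℝ) (hC : ∀ i x, ‖ψ i x‖ ≤ C i) (x : ι → X) :
    ‖(Matrix.of fun i j => φ i (x j) : Matrix ι ι ℂ).det‖ ≤
      (Fintype.card ι).factorial * ∏ i, C i := by
  let := LinearOrder.lift' r hr
  convert norm_det_le_of_triangular φ ψ c (fun i x => ?_) C hC x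
  exact hψ i x

theorem prod_le_of_norm_det_le_lift [Nonempty X] {S : Type*} [LinearOrder S] {r : ι → S}
    (hr : Function.Injective r) (φ : ι → X → ℂ) (T : ι → ℝ) (h0 : ∀ i, 0 ≤ T i)
    (hT : ∀ i (c : ι → ℂ) C,
      (∀ x, ‖φ i x + ∑ j, if r j < r i then c j * φ j x else 0‖ ≤ C) → T i ≤ C)
    (B : ℝ) (hB : ∀ x : ι → X, ‖(Matrix.of fun i j => φ i (x j) : Matrix ι ι ℂ).det‖ ≤ B) :
    ∏ i, T i ≤ B := by
  let := LinearOrder.lift' r hr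
  refine prod_le_of_norm_det_le φ T h0 (fun i c C hC => hT i c C fun x => ?_) B fun x => ?_
  · exact hC x
  · convert hB x

open scoped ComplexOrder in
/-- The arithmetic-geometric mean form of Hadamard's inequality. -/
theorem norm_det_sq_le_card_pow (B : Matrix ι ι ℂ)
    (hB : ∑ i, ∑ j, ‖B i j‖ ^ 2 ≤ (Fintype.card ι : ℝ) * Fintype.card ι) :
    ‖B.det‖ ^ 2 ≤ (Fintype.card ι : ℝ) ^ Fintype.card ι := by
  rcases isEmpty_or_nonempty ι with h | h
  · simp
  -- The eigenvalues of `B Bᴴ` have product `‖det B‖²` and sum equal to the squared Frobenius norm,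
  -- so the bound is the AM-GM inequality for them.
  have hP : (B * B.conjTranspose).PosSemidef := Matrix.posSemidef_self_mul_conjTranspose B
  set lam := hP.isHermitian.eigenvalues
  have hlam : ∀ i, 0 ≤ lam i := hP.eigenvalues_nonneg
  have hN : (0 : ℝ) < Fintype.card ι := Nat.cast_pos.2 Fintype.card_pos
  have hdet : ‖B.det‖ ^ 2 = ∏ i, lam i := by
    have := hP.isHermitian.det_eq_prod_eigenvalues
    rw [Matrix.det_mul, Matrix.det_conjTranspose, RCLike.star_def, Complex.mul_conj,
      Complex.normSq_eq_norm_sq] at this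
    refine Complex.ofReal_injective (this.trans ?_)
    rw [Complex.ofReal_prod]
    rfl
  have htr : ∑ i, lam i = ∑ i, ∑ j, ‖B i j‖ ^ 2 := by
    have := hP.isHermitian.trace_eq_sum_eigenvalues
    simp only [Matrix.trace, Matrix.diag_apply, Matrix.mul_apply, Matrix.conjTranspose_apply,
      RCLike.star_def, Complex.mul_conj, Complex.normSq_eq_norm_sq] at this
    refine Complex.ofReal_injective (Eq.trans ?_ (this.symm.trans ?_))
    · rw [Complex.ofReal_sum]
      rfl
    · push_cast
      rfl
  have := Real.geom_mean_le_arith_mean univ (fun _ => 1) lam (fun _ _ => zero_le_one)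
    (by simpa using hN) (fun i _ => hlam i)
  simp only [Real.rpow_one, one_mul, Finset.sum_const, Finset.card_univ, nsmul_eq_mul, mul_one]
    at this
  rw [hdet]
  have h2 : (∏ i, lam i) ^ ((Fintype.card ι : ℝ)⁻¹) ≤ Fintype.card ι :=
    this.trans (by rw [div_le_iff₀ hN, htr]; exact hB)
  have h3 := pow_le_pow_left₀ (Real.rpow_nonneg (Finset.prod_nonneg fun i _ => hlam i) _) h2
    (Fintype.card ι)
  rwa [Real.rpow_inv_natCast_pow (Finset.prod_nonneg fun i _ => hlam i) Fintype.card_ne_zero] at h3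

/-- Andréief's identity for Gram determinants. -/
theorem factorial_mul_det_integral [MeasurableSpace X] (μ : Measure X) [SigmaFinite μ]
    (f : ι → X → ℂ)
    (hf : ∀ i j, Integrable (fun x => f i x * (starRingEnd ℂ) (f j x)) μ) :
    ((Fintype.card ι).factorial : ℂ) *
      (Matrix.of fun i j => ∫ x, f i x * (starRingEnd ℂ) (f j x) ∂μ : Matrix ι ι ℂ).det =
    ((∫ x : ι → X, ‖(Matrix.of fun i j => f i (x j) : Matrix ι ι ℂ).det‖ ^ 2
      ∂Measure.pi fun _ => μ : ℝ) : ℂ) := by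
  set G : Matrix ι ι ℂ := Matrix.of fun i j => ∫ x, f i x * (starRingEnd ℂ) (f j x) ∂μ with hG
  set s : Equiv.Perm ι → ℂ := fun σ => ((Equiv.Perm.sign σ : ℤ) : ℂ) with hs
  have hsc : ∀ σ, (starRingEnd ℂ) (s σ) = s σ := fun σ => by simp [hs]
  have hss : ∀ σ, s σ * s σ = 1 := fun σ => by
    simp only [hs, ← Int.cast_mul]
    rw [← Units.val_mul, Int.units_mul_self]; simp
  have hexp : ∀ x : ι → X, ((‖(Matrix.of fun i j => f i (x j) : Matrix ι ι ℂ).det‖ ^ 2 : ℝ) : ℂ) =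
      ∑ σ : Equiv.Perm ι, ∑ τ : Equiv.Perm ι, s σ * s τ *
        ∏ i, (f (σ i) (x i) * (starRingEnd ℂ) (f (τ i) (x i))) := by
    intro x
    rw [← Complex.normSq_eq_norm_sq, ← Complex.mul_conj, Matrix.det_apply', map_sum,
      Finset.sum_mul_sum]
    refine Finset.sum_congr rfl fun σ _ => Finset.sum_congr rfl fun τ _ => ?_
    rw [map_mul, hsc τ, map_prod, Finset.prod_mul_distrib]
    simp only [Matrix.of_apply]
    ring
  have hint : ∀ σ τ : Equiv.Perm ι, Integrable (fun x : ι → X =>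
      ∏ i, (f (σ i) (x i) * (starRingEnd ℂ) (f (τ i) (x i)))) (Measure.pi fun _ => μ) :=
    fun σ τ => Integrable.fintype_prod (f := fun i x => f (σ i) x * (starRingEnd ℂ) (f (τ i) x))
      fun i => hf _ _
  rw [← integral_complex_ofReal]
  simp only [hexp]
  rw [integral_finsetSum _ fun σ _ => integrable_finsetSum _ fun τ _ => (hint σ τ).const_mul _]
  -- For fixed `σ` the sum over `τ` is the determinant of `G` up to a permutation by `σ`, whose sign
  -- cancels `s σ`; each of the `N!` choices of `σ` thus contributes the same.
  have hin : ∀ σ : Equiv.Perm ι, ∫ x : ι → X, ∑ τ : Equiv.Perm ι, s σ * s τ *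
      ∏ i, (f (σ i) (x i) * (starRingEnd ℂ) (f (τ i) (x i))) ∂(Measure.pi fun _ => μ) = G.det := by
    intro σ
    rw [integral_finsetSum _ fun τ _ => (hint σ τ).const_mul _]
    have h1 : ∀ τ : Equiv.Perm ι, ∫ x : ι → X, s σ * s τ *
        ∏ i, (f (σ i) (x i) * (starRingEnd ℂ) (f (τ i) (x i))) ∂(Measure.pi fun _ => μ) =
        s σ * (s τ * ∏ i, G.transpose.submatrix id σ (τ i) i) := by
      intro τ
      rw [integral_const_mul, mul_assoc]
      congr 2
      exact integral_fintype_prod_eq_prod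
        (f := fun i x => f (σ i) x * (starRingEnd ℂ) (f (τ i) x))
    simp only [h1]
    rw [← Finset.mul_sum, ← Matrix.det_apply', Matrix.det_permute', Matrix.det_transpose,
      ← mul_assoc]
    change s σ * s σ * _ = _
    rw [hss, one_mul]
  simp only [hin]
  simp [Fintype.card_perm]

end Determinants

/-! ### Chebyshev constants -/

section Chebyshev

open Finset MvPolynomial

variable {d : ℕ} {K : Set (Fin d → ℂ)}

/-- The exponent of a monomial as a finitely supported function. -/
noncomputable def Exponent.toFinsupp {n : ℕ} (α : Exponent d n) : Fin d →₀ ℕ :=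
  Finsupp.equivFunOnFinite.symm α.1

theorem Exponent.toFinsupp_injective {n : ℕ} :
    Function.Injective (Exponent.toFinsupp : Exponent d n → _) :=
  Finsupp.equivFunOnFinite.symm.injective.comp Subtype.val_injective

/-- The position of an exponent in the lexicographic order. -/
noncomputable def Exponent.rank {n : ℕ} (α : Exponent d n) : MonomialOrder.lex (σ := Fin d) |>.syn :=
  MonomialOrder.lex.toSyn α.toFinsupp

theorem Exponent.rank_injective {n : ℕ} : Function.Injective (Exponent.rank : Exponent d n → _) :=
  MonomialOrder.lex.toSyn.injective.comp Exponent.toFinsupp_injective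

theorem Exponent.sum_toFinsupp {n : ℕ} (α : Exponent d n) :
    (α.toFinsupp.sum fun _ => id) = ∑ i, α.1 i :=
  Finsupp.sum_fintype _ _ fun _ => rfl

/-- The values of a weighted monomial. -/
noncomputable def weightedMonomial (w : K → ℝ) (n : ℕ) (α : Exponent d n) (z : K) : ℂ :=
  monomialFun α (z : Fin d → ℂ) * ((w z ^ n : ℝ) : ℂ)

theorem eval_eq_sum_exponent {n : ℕ} (p : MvPolynomial (Fin d) ℂ) (hp : p.totalDegree ≤ n)
    (z : Fin d → ℂ) : eval z p = ∑ α : Exponent d n, p.coeff α.toFinsupp * monomialFun α z := by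
  rw [eval_eq']
  refine Eq.trans ?_ (Finset.sum_map univ ⟨_, Exponent.toFinsupp_injective (n := n)⟩
    (fun β : Fin d →₀ ℕ => p.coeff β * ∏ i, z i ^ β i))
  refine Finset.sum_subset (fun β hβ => ?_) fun β _ hβ => ?_
  · refine Finset.mem_map.2 ⟨⟨β, ?_⟩, mem_univ _, ?_⟩
    · refine le_trans ?_ ((le_totalDegree hβ).trans hp)
      rw [Finsupp.sum_fintype _ _ fun _ => rfl]
    · ext i
      rfl
  · rw [notMem_support_iff.1 hβ, zero_mul]

/-- Bounds for the weighted values on `K` of polynomials of degree at most `n` whose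
lexicographically leading monomial is `z ^ α` with coefficient one. -/
def chebyshevBounds (w : K → ℝ) (n : ℕ) (α : Fin d →₀ ℕ) : Set ℝ :=
  {C | 0 ≤ C ∧ ∃ p : MvPolynomial (Fin d) ℂ, p.totalDegree ≤ n ∧
    MonomialOrder.lex.toSyn (MonomialOrder.lex.degree p) ≤ MonomialOrder.lex.toSyn α ∧
    p.coeff α = 1 ∧ ∀ z : K, ‖eval (z : Fin d → ℂ) p‖ * w z ^ n ≤ C}

/-- The weighted Chebyshev constants. -/
noncomputable def chebyshevConstant (w : K → ℝ) (n : ℕ) (α : Fin d →₀ ℕ) : ℝ :=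
  sInf (chebyshevBounds w n α)

theorem bddBelow_chebyshevBounds (w : K → ℝ) (n : ℕ) (α : Fin d →₀ ℕ) :
    BddBelow (chebyshevBounds w n α) := ⟨0, fun _ h => h.1⟩

theorem chebyshevConstant_nonneg (w : K → ℝ) (n : ℕ) (α : Fin d →₀ ℕ) :
    0 ≤ chebyshevConstant w n α := Real.sInf_nonneg fun _ h => h.1

/-- The product of two extremal candidates is a candidate: lexicographic leading terms multiply,
total degrees add, and so do the powers of `w`. -/
theorem mul_mem_chebyshevBounds {w : K → ℝ} (hw : ∀ z, 0 ≤ w z) {n m : ℕ} {α β : Fin d →₀ ℕ}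
    {C D : ℝ} (hC : C ∈ chebyshevBounds w n α) (hD : D ∈ chebyshevBounds w m β) :
    C * D ∈ chebyshevBounds w (n + m) (α + β) := by
  obtain ⟨hC0, p, hp, hpα, hp1, hpC⟩ := hC
  obtain ⟨hD0, q, hq, hqβ, hq1, hqD⟩ := hD
  refine ⟨mul_nonneg hC0 hD0, p * q, (totalDegree_mul p q).trans (add_le_add hp hq), ?_, ?_,
    fun z => ?_⟩
  · refine MonomialOrder.degree_mul_le.trans ?_
    simp only [map_add]
    exact add_le_add hpα hqβ
  · rw [MonomialOrder.coeff_mul_of_add_of_degree_le hpα hqβ, hp1, hq1, one_mul]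
  · rw [map_mul, norm_mul, pow_add, mul_mul_mul_comm]
    exact mul_le_mul (hpC z) (hqD z) (mul_nonneg (norm_nonneg _) (pow_nonneg (hw z) _)) hC0

theorem le_mul_csInf {s : Set ℝ} (hs : s.Nonempty) {a b : ℝ} (hb : 0 ≤ b)
    (h : ∀ x ∈ s, a ≤ b * x) : a ≤ b * sInf s := by
  rcases hb.eq_or_lt with rfl | hb
  · obtain ⟨x, hx⟩ := hs
    simpa using h x hx
  · rw [← div_le_iff₀' hb]
    exact le_csInf hs fun x hx => (div_le_iff₀' hb).2 (h x hx)

theorem chebyshevConstant_add_le {w : K → ℝ} (hw : ∀ z, 0 ≤ w z) {n m : ℕ} {α β : Fin d →₀ ℕ}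
    (hα : (chebyshevBounds w n α).Nonempty) (hβ : (chebyshevBounds w m β).Nonempty) :
    chebyshevConstant w (n + m) (α + β) ≤ chebyshevConstant w n α * chebyshevConstant w m β := by
  refine le_mul_csInf hβ (chebyshevConstant_nonneg _ _ _) fun D hD => ?_
  rw [mul_comm]
  refine le_mul_csInf hα hD.1 fun C hC => ?_
  rw [mul_comm]
  exact csInf_le (bddBelow_chebyshevBounds _ _ _) (mul_mem_chebyshevBounds hw hC hD)

theorem exists_weightedMonomial_bound (hK : IsCompact K) {w : K → ℝ} (h0 : ∀ z, 0 ≤ w z)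
    (hw : UpperSemicontinuous w) (n : ℕ) :
    ∃ M, 0 ≤ M ∧ ∀ (α : Exponent d n) z, ‖weightedMonomial w n α z‖ ≤ M := by
  have : CompactSpace K := isCompact_iff_compactSpace.1 hK
  obtain ⟨A, hA⟩ := (hw.upperSemicontinuousOn Set.univ).bddAbove_of_isCompact isCompact_univ
  have hB : ∀ α : Exponent d n, ∃ B, ∀ z : K, ‖monomialFun α (z : Fin d → ℂ)‖ ≤ B := fun α => by
    have hc : Continuous fun z : K => monomialFun α (z : Fin d → ℂ) := by
      unfold monomialFun
      exact continuous_finsetProd _ fun i _ =>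
        ((continuous_apply i).comp continuous_subtype_val).pow _
    obtain ⟨B, hB⟩ := isCompact_univ.exists_bound_of_continuousOn hc.continuousOn
    exact ⟨B, fun z => hB z trivial⟩
  choose B hB using hB
  refine ⟨∑ α, |B α| * |A| ^ n, by positivity, fun α z => ?_⟩
  refine le_trans ?_ (Finset.single_le_sum (f := fun α => |B α| * |A| ^ n)
    (fun _ _ => by positivity) (mem_univ α))
  rw [weightedMonomial, norm_mul, Complex.norm_real, Real.norm_of_nonneg (pow_nonneg (h0 z) _)]
  have : w z ≤ |A| := (hA ⟨z, trivial, rfl⟩).trans (le_abs_self _)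
  exact mul_le_mul ((hB α z).trans (le_abs_self _)) (pow_le_pow_left₀ (h0 z) this n)
    (pow_nonneg (h0 z) _) (abs_nonneg _)

/-- With its converse `exists_of_mem_chebyshevBounds`, this translates polynomials into the
triangular combinations of the determinant lemmas. The lexicographic order is not graded, so the
bound on the total degree is tracked separately. -/
theorem mem_chebyshevBounds {w : K → ℝ} (h0 : ∀ z, 0 ≤ w z) {n : ℕ} [Nonempty K]
    (α : Exponent d n) (c : Exponent d n → ℂ) {C : ℝ}
    (hC : ∀ z, ‖weightedMonomial w n α z +
      ∑ β, if β.rank < α.rank then c β * weightedMonomial w n β z else 0‖ ≤ C) :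
    C ∈ chebyshevBounds w n α.toFinsupp := by
  set p : MvPolynomial (Fin d) ℂ := monomial α.toFinsupp 1 +
    ∑ β : Exponent d n, if β.rank < α.rank then monomial β.toFinsupp (c β) else 0 with hp
  have hcoeff : ∀ γ, p.coeff γ = (if α.toFinsupp = γ then 1 else 0) +
      ∑ β : Exponent d n, if β.rank < α.rank then (if β.toFinsupp = γ then c β else 0) else 0 := fun γ => by
    rw [hp, coeff_add, coeff_sum, coeff_monomial]
    congr 1
    refine Finset.sum_congr rfl fun β _ => ?_
    split_ifs <;> simp_all [coeff_monomial]
  have hdeg : p.totalDegree ≤ n := by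
    have hm : ∀ (β : Exponent d n) (a : ℂ), (monomial β.toFinsupp a).totalDegree ≤ n := fun β a =>
      (totalDegree_monomial_le _ _).trans (by rw [Exponent.sum_toFinsupp]; exact β.2)
    refine (totalDegree_add _ _).trans (max_le (hm _ _) ?_)
    refine totalDegree_finsetSum_le fun β _ => ?_
    split_ifs
    · exact hm _ _
    · simp
  refine ⟨(norm_nonneg _).trans (hC (Classical.arbitrary K)), p, hdeg, ?_, ?_, fun z => ?_⟩
  · rw [MonomialOrder.degree_le_iff]
    intro γ hγ
    by_contra hlt
    refine mem_support_iff.1 hγ ?_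
    have hne : α.toFinsupp ≠ γ := fun h => hlt (h ▸ le_rfl)
    rw [hcoeff, if_neg hne, zero_add]
    refine Finset.sum_eq_zero fun β _ => ?_
    split_ifs with h1 h2
    · exact absurd (h2 ▸ h1.le) hlt
    · rfl
    · rfl
  · rw [hcoeff, if_pos rfl, Finset.sum_eq_zero, add_zero]
    intro β _
    split_ifs with h1 h2
    · exact absurd (congrArg _ h2) h1.ne
    · rfl
    · rfl
  · refine le_of_eq_of_le ?_ (hC z)
    rw [← Real.norm_of_nonneg (pow_nonneg (h0 z) n), ← Complex.norm_real, ← norm_mul]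
    congr 1
    have hev : ∀ (β : Exponent d n) (a : ℂ), eval (z : Fin d → ℂ) (monomial β.toFinsupp a) =
        a * monomialFun β (z : Fin d → ℂ) := fun β a => by
      rw [eval_monomial, Finsupp.prod_fintype _ _ fun _ => pow_zero _]
      rfl
    rw [hp, map_add, map_sum, hev, one_mul, add_mul, Finset.sum_mul, weightedMonomial]
    congr 1
    refine Finset.sum_congr rfl fun β _ => ?_
    split_ifs
    · rw [hev, weightedMonomial]; ring
    · simp

theorem exists_of_mem_chebyshevBounds {w : K → ℝ} (h0 : ∀ z, 0 ≤ w z) {n : ℕ}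
    (α : Exponent d n) {C : ℝ} (hC : C ∈ chebyshevBounds w n α.toFinsupp) :
    ∃ c : Exponent d n → ℂ, ∀ z, ‖weightedMonomial w n α z +
      ∑ β, if β.rank < α.rank then c β * weightedMonomial w n β z else 0‖ ≤ C := by
  obtain ⟨_, p, hp, hpα, hp1, hpC⟩ := hC
  refine ⟨fun β => p.coeff β.toFinsupp, fun z => le_of_eq_of_le ?_ (hpC z)⟩
  rw [← Real.norm_of_nonneg (pow_nonneg (h0 z) n), ← Complex.norm_real, ← norm_mul,
    eval_eq_sum_exponent p hp]
  congr 1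
  have : ∀ β : Exponent d n, p.coeff β.toFinsupp * monomialFun β (z : Fin d → ℂ) =
      (if β = α then monomialFun β (z : Fin d → ℂ) else 0) +
      if β.rank < α.rank then p.coeff β.toFinsupp * monomialFun β (z : Fin d → ℂ) else 0 := fun β => by
    rcases lt_trichotomy β.rank α.rank with h | h | h
    · simp [h, ne_of_apply_ne _ h.ne]
    · obtain rfl := Exponent.rank_injective h
      simp [hp1]
    · rw [MonomialOrder.coeff_eq_zero_of_lt (hpα.trans_lt h)]
      simp [ne_of_apply_ne _ h.ne', h.not_gt]
  rw [Finset.sum_congr rfl fun β _ => this β]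
  simp only [Finset.sum_add_distrib, add_mul, Finset.sum_ite_eq', mem_univ, if_true,
    Finset.sum_mul, ite_mul, zero_mul]
  simp only [weightedMonomial, mul_assoc]

theorem chebyshevBounds_nonempty [Nonempty K] (hK : IsCompact K) {w : K → ℝ} (h0 : ∀ z, 0 ≤ w z)
    (hw : UpperSemicontinuous w) {n : ℕ} (α : Exponent d n) :
    (chebyshevBounds w n α.toFinsupp).Nonempty := by
  obtain ⟨M, -, hM⟩ := exists_weightedMonomial_bound hK h0 hw n
  exact ⟨M, mem_chebyshevBounds h0 α 0 fun z => by simpa using hM α z⟩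

/-- The Chebyshev constant of a homogeneous exponent in `d + 1` variables. -/
noncomputable def homogeneousChebyshev (w : K → ℝ) (a : Fin (d + 1) →₀ ℕ) : ℝ :=
  chebyshevConstant w (∑ i, a i) a.tail

theorem sum_tail_le (a : Fin (d + 1) →₀ ℕ) : ∑ i, a.tail i ≤ ∑ i, a i := by
  rw [Fin.sum_univ_succ]
  exact Nat.le_add_left _ _

/-- The total size of `a` records `n` and its tail records `α`, so adding vectors adds both at once;
this is the form of submultiplicativity that the simplex averages need. -/
theorem homogeneousChebyshev_add_le [Nonempty K] (hK : IsCompact K) {w : K → ℝ}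
    (h0 : ∀ z, 0 ≤ w z) (hw : UpperSemicontinuous w) (a b : Fin (d + 1) →₀ ℕ) :
    homogeneousChebyshev w (a + b) ≤ homogeneousChebyshev w a * homogeneousChebyshev w b := by
  have hne : ∀ a : Fin (d + 1) →₀ ℕ, (chebyshevBounds w (∑ i, a i) a.tail).Nonempty := fun a => by
    convert chebyshevBounds_nonempty hK h0 hw ⟨a.tail, sum_tail_le a⟩
    ext i
    rfl
  have := chebyshevConstant_add_le h0 (hne a) (hne b)
  have htail : (a + b).tail = a.tail + b.tail := by
    ext i
    rfl
  rw [← Finset.sum_add_distrib, ← htail] at this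
  exact this

/-- Homogenization: the coordinate `0` is the slack `n - |α|`. -/
theorem prod_finsuppAntidiag_eq_prod_exponent {M : Type*} [CommMonoid M] (n : ℕ)
    (g : (Fin (d + 1) →₀ ℕ) → M) :
    ∏ a ∈ finsuppAntidiag univ n, g a =
      ∏ α : Exponent d n, g (α.toFinsupp.cons (n - ∑ i, α.1 i)) := by
  symm
  refine Finset.prod_bij' (fun α _ => α.toFinsupp.cons (n - ∑ i, α.1 i))
    (fun a ha => ⟨a.tail, (sum_tail_le a).trans_eq (mem_finsuppAntidiag.1 ha).1⟩) ?_ ?_ ?_ ?_ ?_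
  · intro α _
    rw [mem_finsuppAntidiag]
    refine ⟨?_, by simp⟩
    change ∑ i, (α.toFinsupp.cons (n - ∑ i, α.1 i)) i = n
    rw [Fin.sum_univ_succ]
    simp only [Finsupp.cons_zero, Finsupp.cons_succ]
    have := α.2
    change _ + ∑ i, α.1 i = n
    omega
  · simp
  · intro α _
    ext i
    simp [Exponent.toFinsupp]
  · intro a ha
    have h := (mem_finsuppAntidiag.1 ha).1
    change ∑ i, a i = n at h
    rw [Fin.sum_univ_succ] at h
    conv_rhs => rw [← a.cons_tail]
    congr 1
    change n - ∑ i : Fin d, a i.succ = a 0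
    omega
  · simp

theorem prod_homogeneousChebyshev (w : K → ℝ) (n : ℕ) :
    ∏ a ∈ finsuppAntidiag univ n, homogeneousChebyshev w a =
      ∏ α : Exponent d n, chebyshevConstant w n α.toFinsupp := by
  rw [prod_finsuppAntidiag_eq_prod_exponent]
  refine Finset.prod_congr rfl fun α _ => ?_
  rw [homogeneousChebyshev]
  congr 1
  rw [Fin.sum_univ_succ]
  simp only [Finsupp.cons_zero, Finsupp.cons_succ]
  have := α.2
  change _ + ∑ i, α.1 i = n
  omega

theorem card_exponent (d n : ℕ) : Fintype.card (Exponent d n) = polyDim d n := by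
  -- The constant function `2` turns the reindexing of products into an equality of powers of `2`,
  -- hence of cardinalities.
  have h := prod_finsuppAntidiag_eq_prod_exponent (d := d) n fun _ => 2
  rw [Finset.prod_const, Finset.prod_const, card_finsuppAntidiag_univ (Fintype.card_fin _)] at h
  exact (Nat.pow_right_injective le_rfl h).symm

/-- The maximal weighted Vandermonde determinant. -/
noncomputable def maxVandermonde (w : K → ℝ) (n : ℕ) : ℝ :=
  ⨆ z : Exponent d n → K, ‖vandermondeDet n (fun α => (z α : Fin d → ℂ))‖ * ∏ α, w (z α) ^ n

theorem norm_vandermondeDet_mul {w : K → ℝ} (h0 : ∀ z, 0 ≤ w z) (n : ℕ) (z : Exponent d n → K) :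
    ‖vandermondeDet n (fun α => (z α : Fin d → ℂ))‖ * ∏ α, w (z α) ^ n =
      ‖(Matrix.of fun α β => weightedMonomial w n α (z β) :
        Matrix (Exponent d n) (Exponent d n) ℂ).det‖ := by
  have := Matrix.det_mul_row (fun β => ((w (z β) ^ n : ℝ) : ℂ))
    (Matrix.of fun α β : Exponent d n => monomialFun α (z β : Fin d → ℂ))
  have h2 : (Matrix.of fun α β => weightedMonomial w n α (z β)) =
      Matrix.of fun i j => ((w (z j) ^ n : ℝ) : ℂ) *
        (Matrix.of fun α β : Exponent d n => monomialFun α (z β : Fin d → ℂ)) i j := by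
    ext i j
    simp [weightedMonomial, mul_comm]
  rw [h2, this, norm_mul, norm_prod, mul_comm, vandermondeDet]
  congr 1
  refine Finset.prod_congr rfl fun β _ => ?_
  rw [Complex.norm_real, Real.norm_of_nonneg (pow_nonneg (h0 _) _)]

theorem norm_det_weightedMonomial_le (hK : IsCompact K) {w : K → ℝ} (h0 : ∀ z, 0 ≤ w z)
    (hw : UpperSemicontinuous w) (n : ℕ) (z : Exponent d n → K) :
    ‖(Matrix.of fun α β => weightedMonomial w n α (z β) :
        Matrix (Exponent d n) (Exponent d n) ℂ).det‖ ≤ maxVandermonde w n := by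
  rw [← norm_vandermondeDet_mul h0]
  obtain ⟨M, -, hM⟩ := exists_weightedMonomial_bound hK h0 hw n
  refine le_ciSup (f := fun z : Exponent d n → K =>
    ‖vandermondeDet n (fun α => (z α : Fin d → ℂ))‖ * ∏ α, w (z α) ^ n) ?_ z
  refine ⟨(Fintype.card (Exponent d n)).factorial * ∏ _ : Exponent d n, M, ?_⟩
  rintro _ ⟨y, rfl⟩
  simp only [norm_vandermondeDet_mul h0]
  -- The trivial triangular change gives a crude bound, enough for the supremum to be a genuine one.
  exact norm_det_le_of_triangular_lift Exponent.rank_injective (weightedMonomial w n) (weightedMonomial w n) 0 (by simp) _ hM y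

theorem maxVandermonde_nonneg {w : K → ℝ} (h0 : ∀ z, 0 ≤ w z) (n : ℕ) : 0 ≤ maxVandermonde w n :=
  Real.iSup_nonneg fun z => by rw [norm_vandermondeDet_mul h0]; exact norm_nonneg _

theorem prod_chebyshevConstant_le [Nonempty K] (hK : IsCompact K) {w : K → ℝ} (h0 : ∀ z, 0 ≤ w z)
    (hw : UpperSemicontinuous w) (n : ℕ) :
    ∏ α : Exponent d n, chebyshevConstant w n α.toFinsupp ≤ maxVandermonde w n :=
  prod_le_of_norm_det_le_lift Exponent.rank_injective (weightedMonomial w n) _ (fun _ => chebyshevConstant_nonneg _ _ _)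
    (fun α c _ hC => csInf_le (bddBelow_chebyshevBounds _ _ _) (mem_chebyshevBounds h0 α c hC)) _
    (norm_det_weightedMonomial_le hK h0 hw n)

theorem maxVandermonde_le [Nonempty K] (hK : IsCompact K) {w : K → ℝ} (h0 : ∀ z, 0 ≤ w z)
    (hw : UpperSemicontinuous w) (n : ℕ) :
    maxVandermonde w n ≤ (Fintype.card (Exponent d n)).factorial *
      ∏ α : Exponent d n, chebyshevConstant w n α.toFinsupp := by
  refine ciSup_le fun z => ?_
  rw [norm_vandermondeDet_mul h0]
  -- Near-minimizers suffice, so no Chebyshev polynomial attaining the infimum is needed.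
  have hε : ∀ ε : ℝ, 0 < ε → ‖(Matrix.of fun α β => weightedMonomial w n α (z β) :
      Matrix (Exponent d n) (Exponent d n) ℂ).det‖ ≤ (Fintype.card (Exponent d n)).factorial *
      ∏ α : Exponent d n, (chebyshevConstant w n α.toFinsupp + ε) := fun ε hε => by
    have : ∀ α : Exponent d n, ∃ c : Exponent d n → ℂ, ∀ z, ‖weightedMonomial w n α z +
        ∑ β, if β.rank < α.rank then c β * weightedMonomial w n β z else 0‖ ≤
          chebyshevConstant w n α.toFinsupp + ε := fun α => by
      obtain ⟨C, hC, hlt⟩ := exists_lt_of_csInf_lt (chebyshevBounds_nonempty hK h0 hw α)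
        (lt_add_of_pos_right (chebyshevConstant w n α.toFinsupp) hε)
      obtain ⟨c, hc⟩ := exists_of_mem_chebyshevBounds h0 α hC
      exact ⟨c, fun z => (hc z).trans hlt.le⟩
    choose c hc using this
    exact norm_det_le_of_triangular_lift Exponent.rank_injective (weightedMonomial w n) _ c (fun _ _ => rfl) _ hc z
  have ht : Tendsto (fun ε : ℝ => ((Fintype.card (Exponent d n)).factorial : ℝ) *
      ∏ α : Exponent d n, (chebyshevConstant w n α.toFinsupp + ε)) (𝓝[>] 0)
      (𝓝 ((Fintype.card (Exponent d n)).factorial *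
      ∏ α : Exponent d n, (chebyshevConstant w n α.toFinsupp + 0))) :=
    tendsto_nhdsWithin_of_tendsto_nhds (Continuous.tendsto (by fun_prop) 0)
  simp only [add_zero] at ht
  exact ge_of_tendsto ht (eventually_nhdsWithin_of_forall fun ε h => hε ε h)

end Chebyshev

/-! ### Gram determinants and optimal measures -/

section GramBounds

open Finset

variable {d : ℕ} {K : Set (Fin d → ℂ)}

theorem measurable_weightedMonomial {w : K → ℝ} (hw : UpperSemicontinuous w) (n : ℕ)
    (α : Exponent d n) : Measurable (weightedMonomial w n α) := by
  have hc : Continuous fun z : K => monomialFun α (z : Fin d → ℂ) := by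
    unfold monomialFun
    exact continuous_finsetProd _ fun i _ =>
      ((continuous_apply i).comp continuous_subtype_val).pow _
  exact hc.measurable.mul (Complex.measurable_ofReal.comp (hw.measurable.pow_const n))

theorem integrable_weightedMonomial_mul_conj (hK : IsCompact K) {w : K → ℝ} (h0 : ∀ z, 0 ≤ w z)
    (hw : UpperSemicontinuous w) (n : ℕ) (ν : Measure K) [IsFiniteMeasure ν]
    (α β : Exponent d n) :
    Integrable (fun z => weightedMonomial w n α z * (starRingEnd ℂ) (weightedMonomial w n β z))
      ν := by
  obtain ⟨M, hM0, hM⟩ := exists_weightedMonomial_bound hK h0 hw n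
  refine Integrable.of_bound ((measurable_weightedMonomial hw n α).mul
    (Complex.continuous_conj.measurable.comp (measurable_weightedMonomial hw n β))).aestronglyMeasurable
    (M * M) (Eventually.of_forall fun z => ?_)
  rw [norm_mul, RCLike.norm_conj]
  exact mul_le_mul (hM α z) (hM β z) (norm_nonneg _) hM0

theorem weightedInner_eq (n : ℕ) (w : K → ℝ) (μ : ProbabilityMeasure K)
    (f g : (Fin d → ℂ) → ℂ) :
    weightedInner n w μ f g = ∫ z : K, (f z * ((w z ^ n : ℝ) : ℂ)) *
      (starRingEnd ℂ) (g z * ((w z ^ n : ℝ) : ℂ)) ∂(μ : Measure K) := by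
  refine integral_congr_ae (Eventually.of_forall fun z => ?_)
  simp only [map_mul, Complex.conj_ofReal, two_mul, pow_add, Complex.ofReal_mul]
  ring

theorem gramMatrix_eq (n : ℕ) (w : K → ℝ) (μ : ProbabilityMeasure K) :
    gramMatrix n w μ = Matrix.of fun α β => ∫ z, weightedMonomial w n α z *
      (starRingEnd ℂ) (weightedMonomial w n β z) ∂(μ : Measure K) := by
  ext α β
  simp only [gramMatrix, Matrix.of_apply, weightedInner_eq, weightedMonomial]

theorem factorial_mul_gramDet (hK : IsCompact K) {w : K → ℝ} (h0 : ∀ z, 0 ≤ w z)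
    (hw : UpperSemicontinuous w) (n : ℕ) (μ : ProbabilityMeasure K) :
    ((Fintype.card (Exponent d n)).factorial : ℝ) * gramDet n w μ =
      ∫ z : Exponent d n → K, ‖(Matrix.of fun α β => weightedMonomial w n α (z β) :
        Matrix (Exponent d n) (Exponent d n) ℂ).det‖ ^ 2
        ∂Measure.pi fun _ => (μ : Measure K) := by
  have := factorial_mul_det_integral (μ : Measure K) (weightedMonomial w n)
    fun α β => integrable_weightedMonomial_mul_conj hK h0 hw n _ α β
  rw [← gramMatrix_eq, ← ofReal_gramDet] at this
  exact_mod_cast this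

theorem gramDet_nonneg (hK : IsCompact K) {w : K → ℝ} (h0 : ∀ z, 0 ≤ w z)
    (hw : UpperSemicontinuous w) (n : ℕ) (μ : ProbabilityMeasure K) : 0 ≤ gramDet n w μ := by
  refine nonneg_of_mul_nonneg_right (a := ((Fintype.card (Exponent d n)).factorial : ℝ)) ?_
    (by positivity)
  rw [factorial_mul_gramDet hK h0 hw]
  exact integral_nonneg fun _ => by positivity

theorem gramDet_le_maxVandermonde_sq (hK : IsCompact K) {w : K → ℝ} (h0 : ∀ z, 0 ≤ w z)
    (hw : UpperSemicontinuous w) (n : ℕ) (μ : ProbabilityMeasure K) :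
    gramDet n w μ ≤ maxVandermonde w n ^ 2 := by
  have h1 : (1 : ℝ) ≤ (Fintype.card (Exponent d n)).factorial :=
    Nat.one_le_cast.2 (Nat.factorial_pos _)
  refine (le_mul_of_one_le_left (gramDet_nonneg hK h0 hw n μ) h1).trans ?_
  rw [factorial_mul_gramDet hK h0 hw]
  refine (integral_mono_of_nonneg (Eventually.of_forall fun _ => by positivity)
    (integrable_const (maxVandermonde w n ^ 2)) (Eventually.of_forall fun z => ?_)).trans_eq ?_
  · exact pow_le_pow_left₀ (norm_nonneg _) (norm_det_weightedMonomial_le hK h0 hw n z) 2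
  · simp

/-- The uniform probability measure on a finite family of points. -/
noncomputable def uniformMeasure {ι X : Type*} [Fintype ι] [Nonempty ι] [MeasurableSpace X]
    (x : ι → X) : ProbabilityMeasure X :=
  ⟨(Fintype.card ι : ENNReal)⁻¹ • ∑ i, Measure.dirac (x i), ⟨by
    simp [ENNReal.inv_mul_cancel]⟩⟩

theorem integral_uniformMeasure {ι X : Type*} [Fintype ι] [Nonempty ι] [MeasurableSpace X]
    [MeasurableSingletonClass X] (x : ι → X) (f : X → ℂ) :
    ∫ y, f y ∂(uniformMeasure x : Measure X) = (Fintype.card ι : ℂ)⁻¹ * ∑ i, f (x i) := by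
  change ∫ y, f y ∂((Fintype.card ι : ENNReal)⁻¹ • ∑ i, Measure.dirac (x i)) = _
  rw [integral_smul_measure, integral_finsetSum_measure fun i _ => integrable_dirac (by simp)]
  simp

instance (d n : ℕ) : Nonempty (Exponent d n) := ⟨⟨0, by simp⟩⟩

/-- For `N` equally weighted points the Gram matrix is `Φ Φᴴ / N` with `Φ` square; this is the
competitor used against a maximizer of the Gram determinant. -/
theorem gramDet_uniformMeasure (n : ℕ) (w : K → ℝ) (z : Exponent d n → K) :
    (Fintype.card (Exponent d n) : ℝ) ^ Fintype.card (Exponent d n) *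
      gramDet n w (uniformMeasure z) =
    ‖(Matrix.of fun α β => weightedMonomial w n α (z β) :
        Matrix (Exponent d n) (Exponent d n) ℂ).det‖ ^ 2 := by
  set Φ : Matrix (Exponent d n) (Exponent d n) ℂ :=
    Matrix.of fun α β => weightedMonomial w n α (z β) with hΦ
  have hN : (Fintype.card (Exponent d n) : ℂ) ≠ 0 := Nat.cast_ne_zero.2 Fintype.card_ne_zero
  have h : (Fintype.card (Exponent d n) : ℂ) • gramMatrix n w (uniformMeasure z) =
      Φ * Φ.conjTranspose := by
    ext α β
    rw [gramMatrix_eq]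
    simp only [Matrix.smul_apply, Matrix.of_apply, integral_uniformMeasure, smul_eq_mul,
      mul_inv_cancel_left₀ hN, Matrix.mul_apply, Matrix.conjTranspose_apply, hΦ, RCLike.star_def]
  have h2 := congrArg Matrix.det h
  rw [Matrix.det_smul, Matrix.det_mul, Matrix.det_conjTranspose, RCLike.star_def,
    Complex.mul_conj, Complex.normSq_eq_norm_sq, ← ofReal_gramDet] at h2
  exact_mod_cast h2

/-- Let `A` express the orthonormal basis in monomials. Orthonormality gives `A G Aᴴ = 1`, so `‖det
A‖² det G = 1`. The columns of `A Φ` have squared norm at most `N` by the Christoffel bound, so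
Hadamard gives `‖det (A Φ)‖² ≤ N^N`. -/
theorem norm_det_sq_le_of_christoffelMaxEqDim (hK : IsCompact K) {w : K → ℝ}
    (h0 : ∀ z, 0 ≤ w z) (hw : UpperSemicontinuous w) (n : ℕ) (μ : ProbabilityMeasure K)
    (hμ : ChristoffelMaxEqDim n w μ) (z : Exponent d n → K) :
    ‖(Matrix.of fun α β => weightedMonomial w n α (z β) :
        Matrix (Exponent d n) (Exponent d n) ℂ).det‖ ^ 2 ≤
    (Fintype.card (Exponent d n) : ℝ) ^ Fintype.card (Exponent d n) * gramDet n w μ := by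
  obtain ⟨q, ⟨hdeg, horth⟩, hmax⟩ := hμ
  set Φ : Matrix (Exponent d n) (Exponent d n) ℂ :=
    Matrix.of fun α β => weightedMonomial w n α (z β) with hΦ
  set A : Matrix (Exponent d n) (Exponent d n) ℂ :=
    Matrix.of fun α β => (q α).coeff β.toFinsupp with hA
  have hq : ∀ α (y : K), MvPolynomial.eval (y : Fin d → ℂ) (q α) * ((w y ^ n : ℝ) : ℂ) =
      ∑ β, A α β * weightedMonomial w n β y := fun α y => by
    rw [eval_eq_sum_exponent _ (hdeg α), Finset.sum_mul]
    simp only [weightedMonomial, hA, Matrix.of_apply, mul_assoc]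
  have hG : A * gramMatrix n w μ * A.conjTranspose = 1 := by
    ext α β
    have h := horth α β
    rw [weightedInner_eq] at h
    simp only [hq, map_sum, map_mul, Finset.sum_mul_sum] at h
    rw [Matrix.one_apply, ← h, gramMatrix_eq]
    have hint : ∀ γ δ, Integrable (fun y => A α γ * weightedMonomial w n γ y *
        ((starRingEnd ℂ) (A β δ) * (starRingEnd ℂ) (weightedMonomial w n δ y)))
        (μ : Measure K) := fun γ δ => by
      refine ((integrable_weightedMonomial_mul_conj hK h0 hw n (μ : Measure K) γ δ).const_mul
        (A α γ * (starRingEnd ℂ) (A β δ))).congr (Eventually.of_forall fun y => ?_)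
      simp only
      ring
    rw [integral_finsetSum _ fun γ _ => integrable_finsetSum _ fun δ _ => hint γ δ]
    simp only [Matrix.mul_apply, Finset.sum_mul, Matrix.conjTranspose_apply, RCLike.star_def]
    rw [Finset.sum_comm]
    refine Finset.sum_congr rfl fun γ _ => ?_
    rw [integral_finsetSum _ fun δ _ => hint γ δ]
    refine Finset.sum_congr rfl fun δ _ => ?_
    rw [Matrix.of_apply, mul_right_comm, ← integral_const_mul]
    refine integral_congr_ae (Eventually.of_forall fun y => ?_)
    simp only
    ring
  have hdetG : ‖A.det‖ ^ 2 * gramDet n w μ = 1 := by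
    have h := congrArg Matrix.det hG
    rw [Matrix.det_mul, Matrix.det_mul, Matrix.det_conjTranspose, Matrix.det_one, mul_right_comm,
      RCLike.star_def, Complex.mul_conj, Complex.normSq_eq_norm_sq, ← ofReal_gramDet] at h
    exact_mod_cast h
  have hQ : ‖(A * Φ).det‖ ^ 2 ≤
      (Fintype.card (Exponent d n) : ℝ) ^ Fintype.card (Exponent d n) := by
    refine norm_det_sq_le_card_pow _ ?_
    rw [Finset.sum_comm]
    refine (Finset.sum_le_card_nsmul _ _ (polyDim d n : ℝ) fun β _ => ?_).trans_eq ?_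
    · refine le_of_eq_of_le ?_ (hmax.2 ⟨z β, rfl⟩)
      refine Finset.sum_congr rfl fun α _ => ?_
      rw [Matrix.mul_apply]
      simp only [hΦ, Matrix.of_apply]
      rw [← hq, norm_mul, Complex.norm_real, Real.norm_of_nonneg (pow_nonneg (h0 _) _), mul_pow,
        ← pow_mul, mul_comm n 2]
    · rw [card_exponent, Finset.card_univ, card_exponent, nsmul_eq_mul]
  rw [Matrix.det_mul, norm_mul, mul_pow] at hQ
  have hG0 := gramDet_nonneg hK h0 hw n μ
  calc ‖Φ.det‖ ^ 2 = ‖A.det‖ ^ 2 * ‖Φ.det‖ ^ 2 * gramDet n w μ := by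
        rw [mul_right_comm, hdetG, one_mul]
    _ ≤ _ := mul_le_mul_of_nonneg_right hQ hG0

/-- The maximal Vandermonde determinant is controlled by the Gram determinant of an optimal
measure. -/
theorem maxVandermonde_sq_le [Nonempty K] (hK : IsCompact K) {w : K → ℝ} (h0 : ∀ z, 0 ≤ w z)
    (hw : UpperSemicontinuous w) (n : ℕ) (μ : ProbabilityMeasure K)
    (hμ : IsOptimalMeasure n w μ) :
    maxVandermonde w n ^ 2 ≤ (polyDim d n : ℝ) ^ polyDim d n * gramDet n w μ := by
  rw [← card_exponent]
  have hG0 := gramDet_nonneg hK h0 hw n μ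
  rw [← Real.le_sqrt (maxVandermonde_nonneg h0 n) (by positivity)]
  refine ciSup_le fun z => ?_
  rw [norm_vandermondeDet_mul h0]
  refine Real.le_sqrt_of_sq_le ?_
  rcases hμ with hμ | hμ
  · rw [← gramDet_uniformMeasure]
    exact mul_le_mul_of_nonneg_left (hμ _) (by positivity)
  · exact norm_det_sq_le_of_christoffelMaxEqDim hK h0 hw n μ hμ z

end GramBounds

/-! ### Asymptotics -/

section Asymptotics

variable {d : ℕ}

theorem polyDim_pos (d n : ℕ) : 0 < polyDim d n := Nat.choose_pos (Nat.le_add_left _ _)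

theorem polyDim_le (d n : ℕ) : polyDim d n ≤ (n + 1) ^ d := by
  rw [← card_exponent]
  refine (Fintype.card_le_of_injective (β := Fin d → Fin (n + 1))
    (fun α i => ⟨α.1 i, Nat.lt_succ_of_le (α.le i)⟩) fun α β h => ?_).trans_eq (by simp)
  exact Subtype.ext (funext fun i => congrArg Fin.val (congrFun h i))

theorem degreeSum_pos (hd : 1 ≤ d) {n : ℕ} (hn : 1 ≤ n) : 0 < degreeSum d n := by
  have : (0 : ℝ) < d := Nat.cast_pos.2 hd
  have : (0 : ℝ) < n := Nat.cast_pos.2 hn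
  have : (0 : ℝ) < polyDim d n := Nat.cast_pos.2 (polyDim_pos d n)
  unfold degreeSum
  positivity

/-- Since `N / m_n = (d + 1) / (d n)` and `N ≤ (n + 1)^d`, the sequence lies between `1` and `(n +
1)^((d + 1) / n)`. -/
theorem tendsto_polyDim_pow_rpow (hd : 1 ≤ d) :
    Tendsto (fun n : ℕ => ((polyDim d n : ℝ) ^ polyDim d n) ^ (1 / degreeSum d n)) atTop
      (𝓝 1) := by
  have hd0 : (0 : ℝ) < d := Nat.cast_pos.2 hd
  have ht : Tendsto (fun n : ℕ => ((n : ℝ) + 1) ^ (((d : ℝ) + 1) / (1 * ((n : ℝ) + 1) + -1))) atTop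
      (𝓝 1) := (tendsto_rpow_div_mul_add ((d : ℝ) + 1) 1 (-1) zero_ne_one).comp
    (tendsto_atTop_add_const_right _ _ tendsto_natCast_atTop_atTop)
  refine tendsto_of_tendsto_of_tendsto_of_le_of_le' tendsto_const_nhds ht ?_ ?_
  · filter_upwards [eventually_ge_atTop 1] with n hn
    have h1 : (1 : ℝ) ≤ polyDim d n := Nat.one_le_cast.2 (polyDim_pos d n)
    exact Real.one_le_rpow (one_le_pow₀ h1) (one_div_nonneg.2 (degreeSum_pos hd hn).le)
  · filter_upwards [eventually_ge_atTop 1] with n hn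
    have hn0 : (0 : ℝ) < n := Nat.cast_pos.2 hn
    have hN : (0 : ℝ) < polyDim d n := Nat.cast_pos.2 (polyDim_pos d n)
    have hle : (polyDim d n : ℝ) ≤ ((n : ℝ) + 1) ^ d := by exact_mod_cast polyDim_le d n
    have he : (polyDim d n : ℝ) * (1 / degreeSum d n) = ((d : ℝ) + 1) / (d * n) := by
      unfold degreeSum
      field_simp
    rw [← Real.rpow_natCast, ← Real.rpow_mul hN.le, he]
    refine (Real.rpow_le_rpow hN.le hle (by positivity)).trans_eq ?_
    rw [← Real.rpow_natCast, ← Real.rpow_mul (by positivity)]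
    congr 1
    rw [one_mul, add_neg_cancel_right]
    field_simp

theorem exists_tendsto_transfiniteDiameterOfOrder (hd : 1 ≤ d) {K : Set (Fin d → ℂ)} [Nonempty K]
    (hK : IsCompact K) {w : K → ℝ} (h0 : ∀ z, 0 ≤ w z) (hw : UpperSemicontinuous w) :
    ∃ L, Tendsto (transfiniteDiameterOfOrder w) atTop (𝓝 L) := by
  have hd0 : (0 : ℝ) < d := Nat.cast_pos.2 hd
  -- The scale `d / (d + 1)` turns `n N` into `m_n`.
  obtain ⟨L, hL⟩ := exists_tendsto_prod_rpow (ι := Fin (d + 1)) (Fintype.card_fin _)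
    (homogeneousChebyshev w) (fun a => chebyshevConstant_nonneg _ _ _)
    (homogeneousChebyshev_add_le hK h0 hw) ((d : ℝ) / (d + 1)) (by positivity)
  have hm : ∀ n : ℕ, (d : ℝ) / (d + 1) * (n * polyDim d n) = degreeSum d n := fun n => by
    unfold degreeSum
    ring
  simp only [prod_homogeneousChebyshev, hm] at hL
  refine ⟨L, ?_⟩
  have hprod : ∀ n, 0 ≤ ∏ α : Exponent d n, chebyshevConstant w n α.toFinsupp := fun n =>
    Finset.prod_nonneg fun _ _ => chebyshevConstant_nonneg _ _ _
  have hup := (tendsto_polyDim_pow_rpow hd).mul hL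
  rw [one_mul] at hup
  refine tendsto_of_tendsto_of_tendsto_of_le_of_le' hL hup ?_ ?_
  · filter_upwards [eventually_ge_atTop 1] with n hn
    exact Real.rpow_le_rpow (hprod n) (prod_chebyshevConstant_le hK h0 hw n)
      (one_div_nonneg.2 (degreeSum_pos hd hn).le)
  · filter_upwards [eventually_ge_atTop 1] with n hn
    rw [← Real.mul_rpow (by positivity) (hprod n)]
    refine Real.rpow_le_rpow (maxVandermonde_nonneg h0 n)
      ((maxVandermonde_le hK h0 hw n).trans (mul_le_mul_of_nonneg_right ?_ (hprod n)))
      (one_div_nonneg.2 (degreeSum_pos hd hn).le)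
    rw [card_exponent]
    exact_mod_cast Nat.factorial_le_pow (polyDim d n)

theorem tendsto_gramDet_rpow (hd : 1 ≤ d) {K : Set (Fin d → ℂ)} [Nonempty K]
    (hK : IsCompact K) {w : K → ℝ} (h0 : ∀ z, 0 ≤ w z) (hw : UpperSemicontinuous w)
    (μ : ℕ → ProbabilityMeasure K) (hμ : ∀ n : ℕ, 1 ≤ n → IsOptimalMeasure n w (μ n)) {L : ℝ}
    (hL : Tendsto (transfiniteDiameterOfOrder w) atTop (𝓝 L)) :
    Tendsto (fun n : ℕ => gramDet n w (μ n) ^ (1 / (2 * degreeSum d n))) atTop (𝓝 L) := by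
  have hκ := tendsto_polyDim_pow_rpow hd
  have hlow := hL.div hκ one_ne_zero
  rw [div_one] at hlow
  have hsq : ∀ n, (maxVandermonde w n ^ 2) ^ (1 / (2 * degreeSum d n)) =
      transfiniteDiameterOfOrder w n := fun n => by
    rw [← Real.rpow_natCast, ← Real.rpow_mul (maxVandermonde_nonneg h0 n)]
    change _ = maxVandermonde w n ^ (1 / degreeSum d n)
    congr 1
    push_cast
    rw [one_div, mul_inv, one_div]
    ring
  refine tendsto_of_tendsto_of_tendsto_of_le_of_le' hlow hL ?_ ?_
  · filter_upwards [eventually_ge_atTop 1] with n hn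
    have hm := degreeSum_pos hd hn
    have h1 : (1 : ℝ) ≤ (polyDim d n : ℝ) ^ polyDim d n :=
      one_le_pow₀ (Nat.one_le_cast.2 (polyDim_pos d n))
    have hG := gramDet_nonneg hK h0 hw n (μ n)
    change transfiniteDiameterOfOrder w n / _ ≤ _
    rw [div_le_iff₀ (by positivity), ← hsq]
    refine (Real.rpow_le_rpow (by positivity) (maxVandermonde_sq_le hK h0 hw n _ (hμ n hn))
      (by positivity)).trans ?_
    rw [Real.mul_rpow (by positivity) hG, mul_comm]
    -- The exponent `1 / (2 m_n)` of `N^N` is relaxed to `1 / m_n`, for which the limit is already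
    -- known.
    refine mul_le_mul_of_nonneg_left (Real.rpow_le_rpow_of_exponent_le h1 ?_) (by positivity)
    exact one_div_le_one_div_of_le hm (by linarith)
  · filter_upwards [eventually_ge_atTop 1] with n hn
    have hm := degreeSum_pos hd hn
    rw [← hsq]
    exact Real.rpow_le_rpow (gramDet_nonneg hK h0 hw n _)
      (gramDet_le_maxVandermonde_sq hK h0 hw n _) (by positivity)

end Asymptotics

end WeightedOptimal

/-- Only the semicontinuity and the nonnegativity of the weight are used: that `{w > 0}` is not
pluripolar is what makes the weighted transfinite diameter positive, not what makes it exist. -/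
theorem mainTheorem2 (d : ℕ) (hd : 1 ≤ d) (K : Set (Fin d → ℂ)) (hK : IsCompact K)
    (w : K → ℝ) (hw : WeightedOptimal.IsAdmissible K w)
    (μ : ℕ → ProbabilityMeasure K)
    (hμ : ∀ n : ℕ, 1 ≤ n → WeightedOptimal.IsOptimalMeasure n w (μ n)) :
    Tendsto (WeightedOptimal.transfiniteDiameterOfOrder w) atTop
        (𝓝 (WeightedOptimal.transfiniteDiameter w)) ∧
      Tendsto
        (fun n : ℕ => WeightedOptimal.gramDet n w (μ n) ^ (1 / (2 * WeightedOptimal.degreeSum d n)))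
        atTop (𝓝 (WeightedOptimal.transfiniteDiameter w)) := by
  have : Nonempty K := (μ 1).nonempty
  obtain ⟨L, hL⟩ :=
    WeightedOptimal.exists_tendsto_transfiniteDiameterOfOrder hd hK hw.nonneg hw.usc
  rw [WeightedOptimal.transfiniteDiameter, hL.limUnder_eq]
  exact ⟨hL, WeightedOptimal.tendsto_gramDet_rpow hd hK hw.nonneg hw.usc μ hμ hL⟩
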